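/- Let $G$ be a compact and connected matrix Lie group, i.e. a compact (hence closed) connected subgroup of $\mathrm{GL}(n,\mathbb{C})$, and let $\mathfrak{g}\subseteq\mathbb{C}^{n\times n}$ be its Lie algebra, i.e. the real vector space of velocities $\gamma'(0)$ of smooth curves $\gamma:\mathbb{R}\to G$ with $\gamma(0)=I$. Let $$U=\{A\in\mathfrak{g} : |\operatorname{Im}\lambda|<\pi \text{ for every eigenvalue } \lambda\in\mathbb{C} \text{ of } A\}.$$ Then the matrix exponential maps $\mathfrak{g}$ into $G$; the set $U$ is a bounded open neighborhood of $0$ in $\mathfrak{g}$; and $\exp$ is real analytic and injective on $U$, its image $\exp(U)$ is open in $G$, and the inverse $\exp(U)\to U$ is real analytic (near each point of $\exp(U)$ it is the restriction to $\exp(U)$ of a real analytic map on an open set of matrices). Moreover, for every $A\in\mathbb{C}^{n\times n}$, the differential $(\mathrm{d}\exp)_A:\mathbb{C}^{n\times n}\to\mathbb{C}^{n\times n}$ of the matrix exponential is singular if and only if $A$ has two eigenvalues that differ by a nonzero integer multiple of $2\pi i$. -/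

import Mathlib

open scoped Matrix.Norms.Operator ContDiff

/-- The subset of the space `M_n(ℂ)` of all matrices formed by the elements of a group `G` of
invertible matrices. -/
def matrixSet {n : ℕ} (G : Subgroup (GL (Fin n) ℂ)) : Set (Matrix (Fin n) (Fin n) ℂ) :=
  (fun g : GL (Fin n) ℂ => (g : Matrix (Fin n) (Fin n) ℂ)) '' (G : Set (GL (Fin n) ℂ))

/-- The Lie algebra of a matrix group `G`: the tangent space to `G` at the identity matrix, that
is, the real vector space of the velocities at time `0` of the smooth curves of matrices that stay
in `G` and pass through the identity matrix at time `0`. -/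
def lieAlgebraOf {n : ℕ} (G : Subgroup (GL (Fin n) ℂ)) :
    Submodule ℝ (Matrix (Fin n) (Fin n) ℂ) where
  carrier := {X | ∃ γ : ℝ → Matrix (Fin n) (Fin n) ℂ,
    ContDiff ℝ ∞ γ ∧ (∀ t, γ t ∈ matrixSet G) ∧ γ 0 = 1 ∧ HasDerivAt γ X 0}
  zero_mem' := ⟨fun _ => 1, contDiff_const, fun _ => ⟨1, G.one_mem, rfl⟩, rfl,
    hasDerivAt_const _ _⟩
  add_mem' := by
    rintro X Y ⟨γ, hγ, hG, h0, hX⟩ ⟨δ, hδ, hD, k0, hY⟩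
    refine ⟨fun t => γ t * δ t, hγ.mul hδ, fun t => ?_, by simp [h0, k0], ?_⟩
    · obtain ⟨g, hg, hgt⟩ := hG t
      obtain ⟨d, hd, hdt⟩ := hD t
      exact ⟨g * d, G.mul_mem hg hd, by simpa using congrArg₂ (· * ·) hgt hdt⟩
    · have h : HasDerivAt (fun t => γ t * δ t) (X * δ 0 + γ 0 * Y) 0 := hX.mul hY
      rwa [h0, k0, mul_one, one_mul] at h
  smul_mem' := by
    rintro c X ⟨γ, hγ, hG, h0, hX⟩
    refine ⟨fun t => γ (c * t), hγ.comp (contDiff_const.mul contDiff_id), fun t => hG _,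
      by simpa using h0, ?_⟩
    have h1 : HasDerivAt (fun t : ℝ => c * t) c 0 := by
      simpa using (hasDerivAt_id (0 : ℝ)).const_mul c
    have h2 : HasDerivAt γ X (c * 0) := by simpa using hX
    exact h2.scomp (0 : ℝ) h1

/-- The set `U` of the elements of the Lie algebra of `G` all of whose (complex) eigenvalues have
imaginary part in `(-π, π)`. -/
def eigenvalueStrip {n : ℕ} (G : Subgroup (GL (Fin n) ℂ)) : Set (lieAlgebraOf G) :=
  {A | ∀ z ∈ spectrum ℂ (A : Matrix (Fin n) (Fin n) ℂ), |z.im| < Real.pi}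

/-- The matrix exponential on the Lie algebra of `G`, with values in the space of matrices. -/
noncomputable def lieExp {n : ℕ} (G : Subgroup (GL (Fin n) ℂ)) (A : lieAlgebraOf G) :
    Matrix (Fin n) (Fin n) ℂ :=
  NormedSpace.exp (A : Matrix (Fin n) (Fin n) ℂ)

/-! ### Differentiating identities of the exponential -/

section BanachAlgebra

variable {𝕂 𝔸 : Type*} [RCLike 𝕂] [NormedRing 𝔸] [NormedAlgebra 𝕂 𝔸]

/-! Write `D` for the differential of `exp` at `A` and `ad` for `X ↦ A X - X A`. Both `D ∘ ad` and
`ad ∘ D` send `X` to `exp(A) X - X exp(A)`, so `ker D` is stable under `ad`, and if nonzero it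
contains an eigenvector `X` of `ad`, of eigenvalue `μ`. There `μ D X = (e^μ - 1) X exp(A)`, while `D
X = exp(A) X` if `μ = 0`. Hence `D` is singular exactly when some eigenvalue `μ ≠ 0` of `ad` has
`e^μ = 1`, and the eigenvalues of `ad` are the differences of eigenvalues of `A`. For `A` in `U`
these differences have imaginary part in `(-2π, 2π)`, so `D` is invertible.

Compactness provides a `G`-invariant positive definite Hermitian form (`exists_invariant_posDef`),
for which the Lie algebra is skew. Its elements are therefore diagonalizable with imaginary
eigenvalues, by conjugations that stay bounded, which bounds `U`. Injectivity is interpolation: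
`Complex.exp` is injective on the strip, so a single polynomial recovers two given elements of `U`
from their exponentials.

Openness of the image is the closed subgroup argument (`eventually_exists_exp_eq`): near `exp(A)`
every matrix is `exp(A + Y) exp(R)` with `Y` in the Lie algebra and `R` small in a complement. If
the product lies in `G` then so does `exp(R)`, and this forces `R = 0`. The same fact makes the
global inverse agree locally on `exp(U)` with the analytic inverse given by the inverse function
theorem. -/

/-- The exponential has velocity `(d exp)_A X` at time `0` along the line `t ↦ A + t X`. -/
theorem hasDerivAt_exp_line {A : 𝔸} {D : 𝔸 →L[𝕂] 𝔸}
    (hD : HasFDerivAt (𝕜 := 𝕂) NormedSpace.exp D A) (X : 𝔸) :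
    HasDerivAt (fun t : 𝕂 => NormedSpace.exp (A + t • X)) (D X) 0 := by
  have h1 : HasDerivAt (fun t : 𝕂 => A + t • X) X 0 := by
    simpa using ((hasDerivAt_id (0 : 𝕂)).smul_const X).const_add A
  have hD' : HasFDerivAt (𝕜 := 𝕂) NormedSpace.exp D (A + (0 : 𝕂) • X) := by simpa using hD
  exact hD'.comp_hasDerivAt (0 : 𝕂) h1

/-- Differentiating the identity `Z exp(Z) = exp(Z) Z`. -/
theorem commutator_fderiv_exp [CompleteSpace 𝔸] {A : 𝔸} {D : 𝔸 →L[𝕂] 𝔸}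
    (hD : HasFDerivAt (𝕜 := 𝕂) NormedSpace.exp D A) (X : 𝔸) :
    A * D X - D X * A = NormedSpace.exp A * X - X * NormedSpace.exp A := by
  have h1 : HasDerivAt (fun t : 𝕂 => A + t • X) X 0 := by
    simpa using ((hasDerivAt_id (0 : 𝕂)).smul_const X).const_add A
  have h2 := hasDerivAt_exp_line hD X
  have h3 := h1.mul h2
  have h4 := h2.mul h1
  have e : (fun t : 𝕂 => A + t • X) * (fun t : 𝕂 => NormedSpace.exp (A + t • X)) =
      (fun t : 𝕂 => NormedSpace.exp (A + t • X)) * (fun t : 𝕂 => A + t • X) := by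
    funext t
    exact (Commute.refl (A + t • X)).exp_right
  rw [e] at h3
  have h5 := h3.unique h4
  simp only [zero_smul, add_zero] at h5
  rw [sub_eq_sub_iff_add_eq_add, add_comm, h5, add_comm]

/-- Differentiating the identity `exp(e^{sX} A e^{-sX}) = e^{sX} exp(A) e^{-sX}`. -/
theorem fderiv_exp_commutator [CompleteSpace 𝔸] {A : 𝔸} {D : 𝔸 →L[𝕂] 𝔸}
    (hD : HasFDerivAt (𝕜 := 𝕂) NormedSpace.exp D A) (X : 𝔸) :
    D (A * X - X * A) = NormedSpace.exp A * X - X * NormedSpace.exp A := by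
  have conj (B : 𝔸) : HasDerivAt (fun s : 𝕂 => NormedSpace.exp (s • X) * B *
      NormedSpace.exp (s • (-X))) (X * B - B * X) 0 := by
    have h1 := hasDerivAt_exp_smul_const (𝕂 := 𝕂) X (0 : 𝕂)
    have h2 := hasDerivAt_exp_smul_const (𝕂 := 𝕂) (-X) (0 : 𝕂)
    have h3 : HasDerivAt (fun s : 𝕂 => NormedSpace.exp (s • X) * B *
      NormedSpace.exp (s • (-X))) _ 0 := (h1.mul_const B).mul h2
    simpa [sub_eq_add_neg] using h3
  have hD' : HasFDerivAt (𝕜 := 𝕂) NormedSpace.exp D (NormedSpace.exp ((0 : 𝕂) • X) * A *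
      NormedSpace.exp ((0 : 𝕂) • (-X))) := by simpa using hD
  have h1 := hD'.comp_hasDerivAt (0 : 𝕂) (conj A)
  have e : NormedSpace.exp ∘ (fun s : 𝕂 => NormedSpace.exp (s • X) * A *
      NormedSpace.exp (s • (-X))) = fun s : 𝕂 => NormedSpace.exp (s • X) * NormedSpace.exp A *
      NormedSpace.exp (s • (-X)) := by
    funext s
    let _ : NormedAlgebra ℚ 𝔸 := NormedAlgebra.restrictScalars ℚ 𝕂 𝔸
    have hc : Commute (s • X) (s • (-X)) := by
      rw [smul_neg]; exact (Commute.refl _).neg_right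
    have h0 : NormedSpace.exp (s • X) * NormedSpace.exp (s • (-X)) = 1 := by
      rw [← NormedSpace.exp_add_of_commute hc, smul_neg, add_neg_cancel, NormedSpace.exp_zero]
    have h0' : NormedSpace.exp (s • (-X)) * NormedSpace.exp (s • X) = 1 := by
      rw [← NormedSpace.exp_add_of_commute hc.symm, smul_neg, neg_add_cancel,
        NormedSpace.exp_zero]
    exact NormedSpace.exp_units_conj (⟨_, _, h0, h0'⟩ : 𝔸ˣ) A
  rw [e] at h1
  have h2 := h1.unique (conj (NormedSpace.exp A))
  rw [← neg_sub, map_neg, h2, neg_sub]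

theorem fderiv_exp_of_commute [CompleteSpace 𝔸] {A : 𝔸} {D : 𝔸 →L[𝕂] 𝔸}
    (hD : HasFDerivAt (𝕜 := 𝕂) NormedSpace.exp D A) {X : 𝔸} (h : Commute A X) :
    D X = NormedSpace.exp A * X := by
  have h1 := hasDerivAt_exp_line hD X
  have h2 := (hasDerivAt_exp_smul_const (𝕂 := 𝕂) X (0 : 𝕂)).const_mul (NormedSpace.exp A)
  have e : (fun t : 𝕂 => NormedSpace.exp (A + t • X)) =
      fun t : 𝕂 => NormedSpace.exp A * NormedSpace.exp (t • X) := by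
    funext t
    let _ : NormedAlgebra ℚ 𝔸 := NormedAlgebra.restrictScalars ℚ 𝕂 𝔸
    exact NormedSpace.exp_add_of_commute (h.smul_right t)
  rw [e] at h1
  simpa using h1.unique h2

/-- The action of the differential of `exp` at `A` on the eigenvectors of `X ↦ A X - X A`. -/
theorem smul_fderiv_exp_of_commutator_eq_smul [CompleteSpace 𝔸] {A : 𝔸} {D : 𝔸 →L[𝕂] 𝔸}
    (hD : HasFDerivAt (𝕜 := 𝕂) NormedSpace.exp D A) {X : 𝔸} {μ : 𝕂}
    (h : A * X - X * A = μ • X) :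
    μ • D X = (NormedSpace.exp μ - 1) • (X * NormedSpace.exp A) := by
  let _ : NormedAlgebra ℚ 𝔸 := NormedAlgebra.restrictScalars ℚ 𝕂 𝔸
  -- The hypothesis reads `A X = X (A + μ)`; exponentiating, `exp(A) X = e^μ X exp(A)`.
  have h1 : SemiconjBy X (A + algebraMap 𝕂 _ μ) A := by
    change X * _ = _
    rw [mul_add, ← Algebra.commutes, ← Algebra.smul_def, ← h]; abel
  have h2 := h1.exp_right
  rw [← map_smul, ← h, fderiv_exp_commutator hD, sub_smul, one_smul, ← h2.eq,
    NormedSpace.exp_add_of_commute (Algebra.commute_algebraMap_right μ A),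
    ← NormedSpace.algebraMap_exp_comm, ← mul_assoc, ← Algebra.commutes, ← Algebra.smul_def]

end BanachAlgebra

/-! ### Spectrum of the commutator map and singularity of the differential -/

section Eigenvalues

variable {n : ℕ}

/-- If `A X - X A = μ X` with `X ≠ 0` then `μ` is a difference of eigenvalues of `A`. -/
theorem exists_spectrum_sub_eq {A X : Matrix (Fin n) (Fin n) ℂ} (hX : X ≠ 0) {μ : ℂ}
    (h : A * X - X * A = μ • X) :
    ∃ z ∈ spectrum ℂ A, ∃ w ∈ spectrum ℂ A, z - w = μ := by
  have hn : Nonempty (Fin n) := by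
    by_contra hn
    rw [not_nonempty_iff] at hn
    exact hX (Subsingleton.elim _ _)
  -- Since `A X = X B`, also `p(A) X = X p(B)`. For `p` the characteristic polynomial of `A` the
  -- left side vanishes, so `p(B)` is singular and `B = A + μ` has an eigenvalue that is also one of
  -- `A`.
  set B : Matrix (Fin n) (Fin n) ℂ := A + algebraMap ℂ _ μ with hB
  have hAX : A * X = X * B := by
    rw [hB, mul_add, ← Algebra.commutes, ← Algebra.smul_def, ← h]; abel
  have hp (p : Polynomial ℂ) : (Polynomial.aeval A p) * X = X * Polynomial.aeval B p := by
    induction p using Polynomial.induction_on' with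
    | add p q hp hq => simp only [map_add, add_mul, mul_add, hp, hq]
    | monomial k a =>
      have hk : A ^ k * X = X * B ^ k := by
        have : SemiconjBy X B A := hAX.symm
        exact (this.pow_right k).symm
      rw [Polynomial.aeval_monomial, Polynomial.aeval_monomial, mul_assoc, hk, ← mul_assoc,
        ← mul_assoc, Algebra.commutes]
  have h0 : X * Polynomial.aeval B A.charpoly = 0 := by
    rw [← hp, Matrix.aeval_self_charpoly, zero_mul]
  have h1 : (0 : ℂ) ∈ spectrum ℂ (Polynomial.aeval B A.charpoly) := by
    rw [spectrum.zero_mem_iff]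
    intro hu
    exact hX ((hu.mul_left_eq_zero).1 h0)
  have hd : 0 < A.charpoly.degree := by
    rw [Matrix.charpoly_degree_eq_dim]
    exact_mod_cast Fintype.card_pos
  rw [spectrum.map_polynomial_aeval_of_degree_pos B _ hd] at h1
  obtain ⟨z, hz, hz0⟩ := h1
  refine ⟨z, Matrix.mem_spectrum_iff_isRoot_charpoly.2 hz0, z - μ, ?_, by ring⟩
  rw [hB, add_comm, ← spectrum.singleton_add_eq] at hz
  obtain ⟨a, ha, w, hw, rfl⟩ := hz
  rw [Set.mem_singleton_iff] at ha
  subst ha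
  simpa using hw

/-- A column eigenvector for `z` times a row eigenvector for `w` is such a matrix, of rank one. -/
theorem exists_commutator_eq_smul {A : Matrix (Fin n) (Fin n) ℂ} {z w : ℂ}
    (hz : z ∈ spectrum ℂ A) (hw : w ∈ spectrum ℂ A) :
    ∃ X : Matrix (Fin n) (Fin n) ℂ, X ≠ 0 ∧ A * X - X * A = (z - w) • X := by
  have key {a : ℂ} (ha : a ∈ spectrum ℂ A) : (algebraMap ℂ _ a - A).det = 0 := by
    rw [spectrum.mem_iff, Matrix.isUnit_iff_isUnit_det, isUnit_iff_ne_zero, not_not] at ha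
    exact ha
  obtain ⟨v, hv, hv0⟩ := Matrix.exists_mulVec_eq_zero_iff.2 (key hz)
  obtain ⟨u, hu, hu0⟩ := Matrix.exists_vecMul_eq_zero_iff.2 (key hw)
  rw [Matrix.sub_mulVec, sub_eq_zero, Algebra.algebraMap_eq_smul_one, Matrix.smul_mulVec,
    Matrix.one_mulVec] at hv0
  rw [Matrix.vecMul_sub, sub_eq_zero, Algebra.algebraMap_eq_smul_one, Matrix.vecMul_smul,
    Matrix.vecMul_one] at hu0
  refine ⟨Matrix.vecMulVec v u, ?_, ?_⟩
  · obtain ⟨i, hi⟩ := Function.ne_iff.1 hv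
    obtain ⟨j, hj⟩ := Function.ne_iff.1 hu
    intro h
    have := congrFun (congrFun h i) j
    rw [Matrix.vecMulVec_apply] at this
    exact mul_ne_zero hi hj this
  · rw [Matrix.mul_vecMulVec, Matrix.vecMulVec_mul, ← hv0, ← hu0, Matrix.smul_vecMulVec,
      Matrix.vecMulVec_smul, sub_smul]

/-- The kernel of the differential of `exp` at `A` is nonzero exactly when two eigenvalues of `A`
differ by a nonzero integer multiple of `2πi`. -/
theorem exists_fderiv_exp_eq_zero_iff {A : Matrix (Fin n) (Fin n) ℂ}
    {D : Matrix (Fin n) (Fin n) ℂ →L[ℂ] Matrix (Fin n) (Fin n) ℂ}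
    (hD : HasFDerivAt (𝕜 := ℂ) NormedSpace.exp D A) :
    (∃ X, X ≠ 0 ∧ D X = 0) ↔ ∃ z ∈ spectrum ℂ A, ∃ w ∈ spectrum ℂ A, ∃ k : ℤ, k ≠ 0 ∧
      z - w = 2 * (Real.pi : ℂ) * Complex.I * (k : ℂ) := by
  have hexp {X : Matrix (Fin n) (Fin n) ℂ} {μ : ℂ} (h : A * X - X * A = μ • X) :
      μ • D X = (Complex.exp μ - 1) • (X * NormedSpace.exp A) := by
    rw [Complex.exp_eq_exp_ℂ]
    exact smul_fderiv_exp_of_commutator_eq_smul hD h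
  constructor
  · rintro ⟨X, hX, hDX⟩
    let T : Module.End ℂ (Matrix (Fin n) (Fin n) ℂ) :=
      LinearMap.mulLeft ℂ A - LinearMap.mulRight ℂ A
    have hT (Y) : T Y = A * Y - Y * A := rfl
    have hK : ∀ Y ∈ LinearMap.ker D.toLinearMap, T Y ∈ LinearMap.ker D.toLinearMap := by
      intro Y hY
      have hY : D Y = 0 := hY
      change D (T Y) = 0
      have h0 : D (A * Y - Y * A) = A * D Y - D Y * A :=
        (fderiv_exp_commutator hD Y).trans (commutator_fderiv_exp hD Y).symm
      rw [hT, h0, hY, mul_zero, zero_mul, sub_zero]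
    have : Nontrivial (LinearMap.ker D.toLinearMap) :=
      ⟨⟨⟨X, hDX⟩, 0, fun h => hX (congrArg Subtype.val h)⟩⟩
    obtain ⟨μ, hμ⟩ := Module.End.exists_eigenvalue (T.restrict hK)
    obtain ⟨⟨Y, hDY⟩, hY⟩ := hμ.exists_hasEigenvector
    have hY0 : Y ≠ 0 := fun h => hY.2 (Subtype.ext h)
    have hTY : A * Y - Y * A = μ • Y := congrArg Subtype.val hY.apply_eq_smul
    have hDY : D Y = 0 := hDY
    have hu := Matrix.isUnit_exp A
    have hμ0 : μ ≠ 0 := by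
      rintro rfl
      rw [zero_smul, sub_eq_zero] at hTY
      have h0 : D Y = NormedSpace.exp A * Y := fderiv_exp_of_commute hD hTY
      rw [h0] at hDY
      exact hY0 (hu.mul_right_eq_zero.1 hDY)
    have h1 := hexp hTY
    rw [hDY, smul_zero, eq_comm, smul_eq_zero, hu.mul_left_eq_zero, or_iff_left hY0, sub_eq_zero,
      Complex.exp_eq_one_iff] at h1
    obtain ⟨k, hk⟩ := h1
    obtain ⟨z, hz, w, hw, hzw⟩ := exists_spectrum_sub_eq hY0 hTY
    refine ⟨z, hz, w, hw, k, ?_, by rw [hzw, hk]; ring⟩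
    rintro rfl
    exact hμ0 (by simpa using hk)
  · rintro ⟨z, hz, w, hw, k, hk, hzw⟩
    obtain ⟨X, hX, h⟩ := exists_commutator_eq_smul hz hw
    refine ⟨X, hX, ?_⟩
    have h1 := hexp h
    have h2 : Complex.exp (z - w) = 1 := Complex.exp_eq_one_iff.2 ⟨k, by rw [hzw]; ring⟩
    rw [h2, sub_self, zero_smul, smul_eq_zero] at h1
    refine h1.resolve_left ?_
    rw [hzw]
    have := Complex.two_pi_I_ne_zero
    exact mul_ne_zero this (by exact_mod_cast hk)

theorem not_bijective_fderiv_exp_iff {A : Matrix (Fin n) (Fin n) ℂ}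
    {D : Matrix (Fin n) (Fin n) ℂ →L[ℂ] Matrix (Fin n) (Fin n) ℂ}
    (hD : HasFDerivAt (𝕜 := ℂ) NormedSpace.exp D A) :
    ¬ Function.Bijective D ↔ ∃ z ∈ spectrum ℂ A, ∃ w ∈ spectrum ℂ A, ∃ k : ℤ, k ≠ 0 ∧
      z - w = 2 * (Real.pi : ℂ) * Complex.I * (k : ℂ) := by
  rw [← exists_fderiv_exp_eq_zero_iff hD, not_iff_comm]
  have h : Function.Injective D ↔ Function.Surjective D :=
    LinearMap.injective_iff_surjective (f := D.toLinearMap)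
  rw [Function.Bijective, ← h, and_self, injective_iff_map_eq_zero]
  push Not
  exact forall_congr' fun X => ⟨fun h hX => by_contra fun h0 => h h0 hX, fun h h0 hX => h0 (h hX)⟩

end Eigenvalues

/-! ### Invariant Hermitian form and diagonalization -/

section Unitarization

variable {n : ℕ}

open MeasureTheory in
open scoped ComplexOrder in
/-- Averaging the standard Hermitian form over a compact group of matrices gives an invariant
positive definite Hermitian form. -/
theorem exists_invariant_posDef {G : Subgroup (GL (Fin n) ℂ)}
    (hG : IsCompact (G : Set (GL (Fin n) ℂ))) :
    ∃ H : Matrix (Fin n) (Fin n) ℂ, H.PosDef ∧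
      ∀ g ∈ matrixSet G, g.conjTranspose * H * g = H := by
  have : CompactSpace G := isCompact_iff_compactSpace.1 hG
  let _ : MeasurableSpace G := borel G
  have : BorelSpace G := ⟨rfl⟩
  let μ : Measure G := Measure.haarMeasure ⊤
  -- The inverse makes `h* F(g) h = F(h⁻¹ g)`, so that left invariance of Haar measure applies.
  let ι (g : G) : Matrix (Fin n) (Fin n) ℂ := ((g⁻¹ : G) : GL (Fin n) ℂ)
  have hι : Continuous ι :=
    Units.continuous_val.comp (continuous_subtype_val.comp continuous_inv)
  let F (g : G) : Matrix (Fin n) (Fin n) ℂ := (ι g).conjTranspose * ι g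
  have hF : Continuous F := hι.matrix_conjTranspose.matrix_mul hι
  let H : Matrix (Fin n) (Fin n) ℂ := Matrix.of fun i j => ∫ g, F g i j ∂μ
  have hint (i j : Fin n) : Integrable (fun g => F g i j) μ :=
    (hF.matrix_elem i j).integrable_of_hasCompactSupport (HasCompactSupport.of_compactSpace _)
  -- Entrywise integration commutes with every linear functional; the ones needed are `M ↦ x* M x`,
  -- for positivity, and the entries of `h* M h`, for invariance.
  have hH (q : Matrix (Fin n) (Fin n) ℂ →ₗ[ℂ] ℂ) : q H = ∫ g, q (F g) ∂μ := by
    have hq (M : Matrix (Fin n) (Fin n) ℂ) :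
        q M = ∑ i, ∑ j, M i j * q (Matrix.single i j 1) := by
      conv_lhs => rw [Matrix.matrix_eq_sum_single M]
      simp only [map_sum]
      refine Finset.sum_congr rfl fun i _ => Finset.sum_congr rfl fun j _ => ?_
      rw [← smul_eq_mul, ← map_smul, Matrix.smul_single, smul_eq_mul, mul_one]
    rw [hq H, integral_congr_ae (ae_of_all _ fun g => hq (F g))]
    rw [integral_finsetSum _ fun i _ => integrable_finsetSum _ fun j _ => (hint i j).mul_const _]
    refine Finset.sum_congr rfl fun i _ => ?_
    rw [integral_finsetSum _ fun j _ => (hint i j).mul_const _]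
    refine Finset.sum_congr rfl fun j _ => ?_
    rw [integral_mul_const]
    rfl
  refine ⟨H, Matrix.PosDef.of_dotProduct_mulVec_pos ?_ fun {x} hx => ?_, ?_⟩
  · ext i j
    have h1 : star (∫ g, F g j i ∂μ) = ∫ g, star (F g j i) ∂μ := integral_conj.symm
    refine h1.trans (integral_congr_ae (ae_of_all _ fun g => ?_))
    exact congrFun (congrFun (Matrix.isHermitian_conjTranspose_mul_self (ι g)) i) j
  · let q : Matrix (Fin n) (Fin n) ℂ →ₗ[ℂ] ℂ :=
      { toFun := fun M => star x ⬝ᵥ M.mulVec x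
        map_add' := fun M N => by rw [Matrix.add_mulVec, dotProduct_add]
        map_smul' := fun c M => by rw [Matrix.smul_mulVec, dotProduct_smul]; rfl }
    change 0 < q H
    rw [hH]
    let f (g : G) : ℝ := ∑ i, ‖(ι g).mulVec x i‖ ^ 2
    have hf : Continuous f := by
      have h1 (i : Fin n) : Continuous fun g => (ι g).mulVec x i :=
        (continuous_apply i).comp (hι.matrix_mulVec continuous_const)
      exact continuous_finsetSum _ fun i _ => (h1 i).norm.pow 2
    have hqf (g : G) : q (F g) = (f g : ℂ) := by
      change star x ⬝ᵥ ((ι g).conjTranspose * ι g).mulVec x = _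
      rw [← Matrix.mulVec_mulVec, Matrix.dotProduct_mulVec, ← Matrix.star_mulVec, dotProduct]
      simp only [f, Complex.ofReal_sum]
      refine Finset.sum_congr rfl fun i _ => ?_
      rw [Pi.star_apply, RCLike.star_def, Complex.conj_mul']
      push_cast
      rfl
    have h1 : ∫ g, q (F g) ∂μ = ((∫ g, f g ∂μ : ℝ) : ℂ) := by
      rw [integral_congr_ae (ae_of_all _ hqf)]
      exact integral_ofReal
    rw [h1]
    have hpos : 0 < ∫ g, f g ∂μ := by
      refine hf.integral_pos_of_hasCompactSupport_nonneg_nonzero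
        (HasCompactSupport.of_compactSpace _) (fun g => by positivity) (x := 1) ?_
      have : ι 1 = 1 := by simp [ι]
      simp only [f, this, Matrix.one_mulVec]
      obtain ⟨i, hi⟩ := Function.ne_iff.1 hx
      refine (Finset.sum_pos' (fun j _ => by positivity) ⟨i, Finset.mem_univ i, ?_⟩).ne'
      have : 0 < ‖x i‖ := norm_pos_iff.2 hi
      positivity
    exact Complex.zero_lt_real.2 hpos
  · rintro _ ⟨h, hh, rfl⟩
    let h' : G := ⟨h, hh⟩
    ext i j
    let q : Matrix (Fin n) (Fin n) ℂ →ₗ[ℂ] ℂ :=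
      Matrix.entryLinearMap ℂ ℂ i j ∘ₗ LinearMap.mulRight ℂ (h : Matrix (Fin n) (Fin n) ℂ) ∘ₗ
        LinearMap.mulLeft ℂ (h : Matrix (Fin n) (Fin n) ℂ).conjTranspose
    have h2 (g : G) : q (F g) = F (h'⁻¹ * g) i j := by
      change ((h : Matrix (Fin n) (Fin n) ℂ).conjTranspose *
        ((ι g).conjTranspose * ι g) * h) i j = _
      have : ι (h'⁻¹ * g) = ι g * (h : Matrix (Fin n) (Fin n) ℂ) := by
        simp only [ι, mul_inv_rev, inv_inv]
        rfl
      simp only [F, this, Matrix.conjTranspose_mul, Matrix.mul_assoc]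
    refine (hH q).trans ?_
    simp_rw [h2]
    exact integral_mul_left_eq_self (fun g => F g i j) h'⁻¹

open scoped ComplexOrder MatrixOrder in
theorem Matrix.PosDef.exists_isUnit_eq_conjTranspose_mul_self {H : Matrix (Fin n) (Fin n) ℂ}
    (hH : H.PosDef) : ∃ B : Matrix (Fin n) (Fin n) ℂ, IsUnit B ∧ H = B.conjTranspose * B := by
  obtain ⟨B, hB⟩ := CStarAlgebra.nonneg_iff_eq_star_mul_self.mp hH.posSemidef.nonneg
  refine ⟨B, ?_, hB⟩
  have h := hH.isUnit
  rw [Matrix.isUnit_iff_isUnit_det] at h ⊢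
  rw [hB, Matrix.det_mul] at h
  exact isUnit_of_mul_isUnit_right h

/-- Differentiate `γ(t)* H γ(t) = H` at `t = 0`. -/
theorem conjTranspose_mul_add_mul_eq_zero_of_mem_lieAlgebraOf {G : Subgroup (GL (Fin n) ℂ)}
    {H A : Matrix (Fin n) (Fin n) ℂ} (hH : ∀ g ∈ matrixSet G, g.conjTranspose * H * g = H)
    (hA : A ∈ lieAlgebraOf G) : A.conjTranspose * H + H * A = 0 := by
  obtain ⟨γ, -, hG, h0, hd⟩ := hA
  have h1 : HasDerivAt (fun t => (γ t).conjTranspose) A.conjTranspose 0 :=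
    (starL' ℝ (A := Matrix (Fin n) (Fin n) ℂ)).toContinuousLinearMap.hasFDerivAt.comp_hasDerivAt
      (0 : ℝ) hd
  have h2 := (h1.mul_const H).mul hd
  have e : ((fun t => (γ t).conjTranspose * H) * γ) = fun _ => H := funext fun t => hH _ (hG t)
  rw [e] at h2
  have h3 := h2.unique (hasDerivAt_const (0 : ℝ) H)
  simpa [h0] using h3

theorem norm_le_of_mem_unitaryGroup {U : Matrix (Fin n) (Fin n) ℂ}
    (hU : U ∈ Matrix.unitaryGroup (Fin n) ℂ) : ‖U‖ ≤ n := by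
  rw [Matrix.linfty_opNorm_def]
  have : (Finset.univ.sup fun i => ∑ j, ‖U i j‖₊) ≤ (n : NNReal) := by
    refine Finset.sup_le fun i _ => ?_
    refine (Finset.sum_le_card_nsmul _ _ 1 fun j _ => ?_).trans (by simp)
    exact entry_norm_bound_of_unitary hU i j
  exact_mod_cast this

/-- The elements of the Lie algebra of a compact group of matrices are diagonalizable with purely
imaginary eigenvalues, by matrices that remain bounded. -/
theorem exists_diagonalization {G : Subgroup (GL (Fin n) ℂ)}
    (hG : IsCompact (G : Set (GL (Fin n) ℂ))) :
    ∃ C : ℝ, ∀ A ∈ lieAlgebraOf G, ∃ (P : (Matrix (Fin n) (Fin n) ℂ)ˣ) (d : Fin n → ℂ),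
      A = P * Matrix.diagonal d * (↑P⁻¹ : Matrix (Fin n) (Fin n) ℂ) ∧
      ‖(P : Matrix (Fin n) (Fin n) ℂ)‖ ≤ C ∧
      ‖(↑P⁻¹ : Matrix (Fin n) (Fin n) ℂ)‖ ≤ C ∧ ∀ i, (d i).re = 0 := by
  obtain ⟨H, hH, hinv⟩ := exists_invariant_posDef hG
  obtain ⟨_, ⟨B, rfl⟩, rfl⟩ := hH.exists_isUnit_eq_conjTranspose_mul_self
  -- The conjugating matrix will be `B⁻¹ V` with `V` unitary. The norm is the maximal row sum, which
  -- is at most `n` for a unitary matrix.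
  refine ⟨max (‖(↑B⁻¹ : Matrix (Fin n) (Fin n) ℂ)‖ * n) (n * ‖(B : Matrix (Fin n) (Fin n) ℂ)‖),
    fun A hA => ?_⟩
  have h1 := conjTranspose_mul_add_mul_eq_zero_of_mem_lieAlgebraOf hinv hA
  have hBB : (B : Matrix (Fin n) (Fin n) ℂ) * (↑B⁻¹ : Matrix (Fin n) (Fin n) ℂ) = 1 := B.mul_inv
  have hBB' : (↑B⁻¹ : Matrix (Fin n) (Fin n) ℂ) * (B : Matrix (Fin n) (Fin n) ℂ) = 1 := B.inv_mul
  set K : Matrix (Fin n) (Fin n) ℂ := ↑B⁻¹ with hK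
  -- As the form is `B* B`, skewness of `A` for it means that `S` is skew-Hermitian, so the spectral
  -- theorem applies to `i S`.
  set S : Matrix (Fin n) (Fin n) ℂ := B * A * K with hS
  have hskew : S.conjTranspose = -S := by
    have hBB'' : K.conjTranspose * (B : Matrix (Fin n) (Fin n) ℂ).conjTranspose = 1 := by
      rw [← Matrix.conjTranspose_mul, hBB, Matrix.conjTranspose_one]
    have h2 : A.conjTranspose * (B : Matrix (Fin n) (Fin n) ℂ).conjTranspose * B =
        - ((B : Matrix (Fin n) (Fin n) ℂ).conjTranspose * (B * A)) := by
      rw [eq_neg_iff_add_eq_zero, ← h1]; simp only [mul_assoc]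
    calc S.conjTranspose
        = K.conjTranspose * (A.conjTranspose * (B : Matrix (Fin n) (Fin n) ℂ).conjTranspose *
            (B * K)) := by
          rw [hBB, mul_one, hS, Matrix.conjTranspose_mul, Matrix.conjTranspose_mul]
      _ = K.conjTranspose * (A.conjTranspose * (B : Matrix (Fin n) (Fin n) ℂ).conjTranspose *
            B) * K := by simp only [mul_assoc]
      _ = -((K.conjTranspose * (B : Matrix (Fin n) (Fin n) ℂ).conjTranspose) * (B * A * K)) := by
          rw [h2]; simp only [mul_assoc, mul_neg, neg_mul]
      _ = -S := by rw [hBB'', one_mul]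
  have hherm : (Complex.I • S).IsHermitian := by
    rw [Matrix.IsHermitian, Matrix.conjTranspose_smul, hskew]
    simp
  let V := hherm.eigenvectorUnitary
  let d : Fin n → ℂ := fun i => -Complex.I * hherm.eigenvalues i
  have hspec : S = (V : Matrix (Fin n) (Fin n) ℂ) * Matrix.diagonal d *
      star (V : Matrix (Fin n) (Fin n) ℂ) := by
    have h2 := hherm.spectral_theorem
    rw [Unitary.conjStarAlgAut_apply] at h2
    have h3 : Matrix.diagonal d = (-Complex.I) •
        Matrix.diagonal ((RCLike.ofReal : ℝ → ℂ) ∘ hherm.eigenvalues) := by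
      rw [← Matrix.diagonal_smul]; rfl
    rw [h3, mul_smul_comm, smul_mul_assoc, ← h2, smul_smul]
    simp
  have hV := V.2
  have hVV : star (V : Matrix (Fin n) (Fin n) ℂ) * V = 1 := Unitary.coe_star_mul_self V
  have hVV' : (V : Matrix (Fin n) (Fin n) ℂ) * star (V : Matrix (Fin n) (Fin n) ℂ) = 1 :=
    Unitary.coe_mul_star_self V
  refine ⟨⟨K * V, star (V : Matrix (Fin n) (Fin n) ℂ) * B, ?_, ?_⟩, d, ?_, ?_, ?_, ?_⟩
  · rw [mul_assoc, ← mul_assoc (V : Matrix (Fin n) (Fin n) ℂ), hVV', one_mul, hBB']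
  · rw [mul_assoc, ← mul_assoc (B : Matrix (Fin n) (Fin n) ℂ), hBB, one_mul, hVV]
  · calc A = (K * B) * A * (K * B) := by rw [hBB', one_mul, mul_one]
      _ = K * S * B := by simp only [hS, mul_assoc]
      _ = _ := by rw [hspec]; simp only [mul_assoc, Units.inv_mk]
  · refine le_max_of_le_left ((norm_mul_le _ _).trans ?_)
    gcongr
    exact norm_le_of_mem_unitaryGroup hV
  · refine le_max_of_le_right ((norm_mul_le _ _).trans ?_)
    gcongr
    exact norm_le_of_mem_unitaryGroup (Unitary.star_mem hV)
  · intro i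
    simp [d]

end Unitarization

/-! ### The closed subgroup argument -/

section ClosedSubmonoid

open Filter Topology

variable {𝔸 : Type*} [NormedRing 𝔸] [NormedAlgebra ℝ 𝔸] [CompleteSpace 𝔸]

/-- Near a point where its differential is bijective, `exp` has an analytic left inverse. -/
theorem exists_analyticAt_leftInverse_exp {A : 𝔸} {D : 𝔸 →L[ℝ] 𝔸}
    (hD : HasFDerivAt (𝕜 := ℝ) NormedSpace.exp D A) (hbij : Function.Bijective D) :
    ∃ ψ : 𝔸 → 𝔸, AnalyticAt ℝ ψ (NormedSpace.exp A) ∧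
      (∀ᶠ B in 𝓝 A, ψ (NormedSpace.exp B) = B) ∧
      ∀ᶠ z in 𝓝 (NormedSpace.exp A), NormedSpace.exp (ψ z) = z := by
  have han : AnalyticAt ℝ (NormedSpace.exp : 𝔸 → 𝔸) A := NormedSpace.exp_analytic A
  let e : 𝔸 ≃L[ℝ] 𝔸 := ContinuousLinearEquiv.ofBijective D
    (LinearMap.ker_eq_bot.2 hbij.1) (LinearMap.range_eq_top.2 hbij.2)
  have he : (e : 𝔸 →L[ℝ] 𝔸) = D := rfl
  have hs : HasStrictFDerivAt NormedSpace.exp (e : 𝔸 →L[ℝ] 𝔸) A := by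
    rw [he, ← hD.fderiv]; exact han.hasStrictFDerivAt
  refine ⟨hs.localInverse, ?_, hs.eventually_left_inverse, hs.eventually_right_inverse⟩
  exact (hs.toOpenPartialHomeomorph NormedSpace.exp).analyticAt_symm' (i := e)
    hs.mem_toOpenPartialHomeomorph_source han hs.hasFDerivAt.fderiv

/-- A closed multiplicative submonoid contains the exponentials of the velocities at the identity
of the curves it contains. -/
theorem exp_mem_of_hasDerivAt {S : Submonoid 𝔸} (hS : IsClosed (S : Set 𝔸)) {γ : ℝ → 𝔸} {X : 𝔸}
    (hγ : ∀ t, γ t ∈ S) (h0 : γ 0 = 1) (hX : HasDerivAt γ X 0) : NormedSpace.exp X ∈ S := by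
  let _ : NormedAlgebra ℚ 𝔸 := NormedAlgebra.restrictScalars ℚ ℝ 𝔸
  have hD : HasFDerivAt (𝕜 := ℝ) (NormedSpace.exp : 𝔸 → 𝔸) (1 : 𝔸 →L[ℝ] 𝔸) 0 :=
    hasFDerivAt_exp_zero
  obtain ⟨ψ, hψ, hl, hr⟩ := exists_analyticAt_leftInverse_exp hD Function.bijective_id
  rw [NormedSpace.exp_zero] at hψ hr
  have hψ1 : ψ 1 = 0 := by simpa using hl.self_of_nhds
  have hψd : HasFDerivAt ψ (1 : 𝔸 →L[ℝ] 𝔸) 1 := by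
    have h1 : HasFDerivAt ψ (fderiv ℝ ψ 1) 1 := hψ.differentiableAt.hasFDerivAt
    have h1' : HasFDerivAt ψ (fderiv ℝ ψ 1) (NormedSpace.exp (0 : 𝔸)) := by
      rwa [NormedSpace.exp_zero]
    have h2 := h1'.comp (0 : 𝔸) hD
    have h3 : HasFDerivAt (ψ ∘ NormedSpace.exp) (1 : 𝔸 →L[ℝ] 𝔸) 0 :=
      (hasFDerivAt_id (0 : 𝔸)).congr_of_eventuallyEq hl
    have h4 : fderiv ℝ ψ 1 = 1 := h2.unique h3
    rwa [h4] at h1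
  have h1 : HasDerivAt (ψ ∘ γ) X 0 := by
    rw [← h0] at hψd
    exact hψd.comp_hasDerivAt (0 : ℝ) hX
  have hu : Tendsto (fun k : ℕ => ((k : ℝ) + 1)⁻¹) atTop (𝓝[≠] 0) := by
    refine tendsto_nhdsWithin_iff.2 ⟨?_, Eventually.of_forall fun k => ?_⟩
    · simpa using tendsto_one_div_add_atTop_nhds_zero_nat (𝕜 := ℝ)
    · exact inv_ne_zero (by positivity)
  have h2 := (hasDerivAt_iff_tendsto_slope_zero.1 h1).comp hu
  -- With `ψ` a local logarithm, the exponential of the `k`-th term is eventually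
  -- `γ(1/(k+1))^(k+1)`, an element of the closed set `S`.
  have h3 : Tendsto (fun k : ℕ => (k + 1) • ψ (γ (((k : ℝ) + 1)⁻¹))) atTop (𝓝 X) := by
    refine h2.congr fun k => ?_
    simp only [Function.comp_apply, h0, hψ1, zero_add, sub_zero, inv_inv]
    rw [← Nat.cast_smul_eq_nsmul ℝ]
    push_cast
    rfl
  have h4 := (NormedSpace.exp_continuous.tendsto X).comp h3
  have h5 : Tendsto (fun k : ℕ => γ (((k : ℝ) + 1)⁻¹)) atTop (𝓝 1) := by
    rw [← h0]
    exact hX.continuousAt.tendsto.comp (tendsto_nhdsWithin_iff.1 hu).1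
  refine hS.mem_of_tendsto h4 ?_
  filter_upwards [h5.eventually hr] with k hk
  rw [Function.comp_apply, NormedSpace.exp_nsmul, hk]
  exact S.pow_mem (hγ _) _

/-- If `exp` maps the nonzero terms of a sequence that tends to `0` into a closed submonoid, then
it maps there the half-line spanned by a limit of their directions. -/
theorem exp_smul_mem_of_tendsto {S : Submonoid 𝔸} (hS : IsClosed (S : Set 𝔸)) {Y : ℕ → 𝔸} {u : 𝔸}
    (hY : ∀ k, NormedSpace.exp (Y k) ∈ S) (h0 : ∀ k, Y k ≠ 0) (hlim : Tendsto Y atTop (𝓝 0))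
    (hu : Tendsto (fun k => ‖Y k‖⁻¹ • Y k) atTop (𝓝 u)) {t : ℝ} (ht : 0 ≤ t) :
    NormedSpace.exp (t • u) ∈ S := by
  let _ : NormedAlgebra ℚ 𝔸 := NormedAlgebra.restrictScalars ℚ ℝ 𝔸
  -- With this choice `m k • Y k` tends to `t • u`, and its exponential is a power of `exp (Y k)`.
  let m (k : ℕ) : ℕ := ⌊t / ‖Y k‖⌋₊
  have hpos (k) : 0 < ‖Y k‖ := norm_pos_iff.2 (h0 k)
  have hn : Tendsto (fun k => ‖Y k‖) atTop (𝓝 0) := by simpa using hlim.norm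
  have hm : Tendsto (fun k => (m k : ℝ) * ‖Y k‖) atTop (𝓝 t) := by
    have h1 : Tendsto (fun k => t - ‖Y k‖) atTop (𝓝 t) := by simpa using hn.const_sub t
    refine tendsto_of_tendsto_of_tendsto_of_le_of_le h1 tendsto_const_nhds (fun k => ?_)
      fun k => ?_
    · have := (Nat.lt_floor_add_one (t / ‖Y k‖)).le
      rw [div_le_iff₀ (hpos k)] at this
      change t - ‖Y k‖ ≤ (⌊t / ‖Y k‖⌋₊ : ℝ) * ‖Y k‖
      linarith
    · have := Nat.floor_le (div_nonneg ht (hpos k).le)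
      rwa [le_div_iff₀ (hpos k)] at this
  have h1 : Tendsto (fun k => m k • Y k) atTop (𝓝 (t • u)) := by
    refine (hm.smul hu).congr fun k => ?_
    rw [smul_smul, mul_assoc, mul_inv_cancel₀ (hpos k).ne', mul_one, Nat.cast_smul_eq_nsmul]
  refine hS.mem_of_tendsto ((NormedSpace.exp_continuous.tendsto _).comp h1)
    (Eventually.of_forall fun k => ?_)
  rw [Function.comp_apply, NormedSpace.exp_nsmul]
  exact S.pow_mem (hY k) _

/-- If a closed submonoid `S` contains the inverses of the exponentials it contains, and the linear
map `p` kills none of the directions of the one-parameter groups in `S`, then no small nonzero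
element of the kernel of `p` has its exponential in `S`. -/
theorem exists_forall_exp_mem_eq_zero [FiniteDimensional ℝ 𝔸] {S : Submonoid 𝔸}
    (hS : IsClosed (S : Set 𝔸))
    (hinv : ∀ Y, NormedSpace.exp Y ∈ S → NormedSpace.exp (-Y) ∈ S) {E : Type*}
    [NormedAddCommGroup E] [NormedSpace ℝ E] (p : 𝔸 →L[ℝ] E)
    (hp : ∀ X : 𝔸, (∀ t : ℝ, NormedSpace.exp (t • X) ∈ S) → p X = 0 → X = 0) :
    ∃ ε > 0, ∀ Y : 𝔸, p Y = 0 → ‖Y‖ < ε → NormedSpace.exp Y ∈ S → Y = 0 := by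
  by_contra! hcon
  have : ProperSpace 𝔸 := FiniteDimensional.proper_real 𝔸
  choose Y hpY hnY hYS hY0 using fun k : ℕ => hcon (1 / ((k : ℝ) + 1)) (by positivity)
  have hlim : Tendsto Y atTop (𝓝 0) :=
    squeeze_zero_norm (fun k => (hnY k).le) tendsto_one_div_add_atTop_nhds_zero_nat
  have hsph (k : ℕ) : ‖Y k‖⁻¹ • Y k ∈ Metric.sphere (0 : 𝔸) 1 := by
    rw [mem_sphere_zero_iff_norm, norm_smul, norm_inv, norm_norm,
      inv_mul_cancel₀ (norm_ne_zero_iff.2 (hY0 k))]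
  -- A counterexample sequence in `ker p` has a limiting unit direction `u`, still in `ker p`. Its
  -- whole one-parameter group lies in `S`, so `hp` gives the absurd `u = 0`.
  obtain ⟨u, hu, φ, hφ, hφu⟩ := (isCompact_sphere (0 : 𝔸) 1).tendsto_subseq hsph
  have hpos {t : ℝ} (ht : 0 ≤ t) : NormedSpace.exp (t • u) ∈ S :=
    exp_smul_mem_of_tendsto hS (fun k => hYS (φ k)) (fun k => hY0 (φ k))
      (hlim.comp hφ.tendsto_atTop) hφu ht
  have hu0 : u = 0 := by
    refine hp u (fun t => ?_) ?_
    · rcases le_total 0 t with ht | ht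
      · exact hpos ht
      · have := hinv _ (hpos (neg_nonneg.2 ht))
        rwa [neg_smul, neg_neg] at this
    · refine tendsto_nhds_unique ((p.continuous.tendsto u).comp hφu) ?_
      refine tendsto_const_nhds.congr fun k => ?_
      simp [hpY]
  rw [mem_sphere_zero_iff_norm, hu0, norm_zero] at hu
  exact zero_ne_one hu

/-- Let `𝔤` be a space of matrices with exponentials in `S` that is large enough near the identity.
If the differential of `exp` at `A ∈ 𝔤` is injective and maps `𝔤` into `exp(A) 𝔤`, then `exp` maps
neighbourhoods of `A` in `𝔤` onto neighbourhoods of `exp(A)` in `S`. -/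
theorem eventually_exists_exp_eq [FiniteDimensional ℝ 𝔸] {S : Submonoid 𝔸} {𝔤 : Submodule ℝ 𝔸}
    {p : 𝔸 →L[ℝ] 𝔤} (hp : ∀ X : 𝔤, p X = X) (hexp : ∀ X ∈ 𝔤, NormedSpace.exp X ∈ S)
    {ε : ℝ} (hε : 0 < ε) (hS : ∀ Y : 𝔸, p Y = 0 → ‖Y‖ < ε → NormedSpace.exp Y ∈ S → Y = 0)
    {A : 𝔤} {D : 𝔸 →L[ℝ] 𝔸} (hD : HasFDerivAt (𝕜 := ℝ) NormedSpace.exp D (A : 𝔸))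
    (hinj : Function.Injective D) (hD𝔤 : ∀ X ∈ 𝔤, NormedSpace.exp (-(A : 𝔸)) * D X ∈ 𝔤)
    {N : Set 𝔤} (hN : N ∈ 𝓝 A) :
    ∀ᶠ z in 𝓝[(S : Set 𝔸)] (NormedSpace.exp (A : 𝔸)), ∃ B ∈ N, NormedSpace.exp (B : 𝔸) = z := by
  let _ : NormedAlgebra ℚ 𝔸 := NormedAlgebra.restrictScalars ℚ ℝ 𝔸
  have hcancel (X : 𝔸) : NormedSpace.exp (-X) * NormedSpace.exp X = 1 := by
    rw [← NormedSpace.exp_add_of_commute (Commute.refl X).neg_left, neg_add_cancel,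
      NormedSpace.exp_zero]
  let q : 𝔸 →L[ℝ] 𝔸 := 𝔤.subtypeL ∘L p
  let r : 𝔸 →L[ℝ] 𝔸 := ContinuousLinearMap.id ℝ 𝔸 - q
  have hq (Z : 𝔸) : q Z = (p Z : 𝔸) := rfl
  have hr (Z : 𝔸) : r Z = Z - q Z := rfl
  have hpr (Z : 𝔸) : p (r Z) = 0 := by
    rw [hr, map_sub, hq, hp, sub_self]
  -- `q` and `r` split `𝔸` into `𝔤` and `ker p`. The map `F` is a local chart at `exp(A)` whose
  -- second factor measures the departure from `exp(𝔤)`.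
  let F (Z : 𝔸) : 𝔸 := NormedSpace.exp ((A : 𝔸) + q Z) * NormedSpace.exp (r Z)
  have hF0 : F 0 = NormedSpace.exp (A : 𝔸) := by simp [F]
  have h1 : HasStrictFDerivAt (fun Z : 𝔸 => NormedSpace.exp ((A : 𝔸) + q Z)) (D ∘L q) 0 := by
    have hs : HasStrictFDerivAt NormedSpace.exp D ((A : 𝔸) + q 0) := by
      rw [map_zero, add_zero, ← hD.fderiv]
      exact (NormedSpace.exp_analytic (𝕂 := ℝ) (A : 𝔸)).hasStrictFDerivAt
    exact hs.comp (0 : 𝔸) (q.hasStrictFDerivAt.const_add _)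
  have h2 : HasStrictFDerivAt (fun Z : 𝔸 => NormedSpace.exp (r Z)) r 0 := by
    have hs : HasStrictFDerivAt NormedSpace.exp (1 : 𝔸 →L[ℝ] 𝔸) (r 0) := by
      rw [map_zero]; exact hasStrictFDerivAt_exp_zero
    exact hs.comp (0 : 𝔸) r.hasStrictFDerivAt
  have h3 := h1.mul' h2
  obtain ⟨F', hF', hF'Z⟩ : ∃ F' : 𝔸 →L[ℝ] 𝔸, HasStrictFDerivAt F F' 0 ∧
      ∀ Z, F' Z = D (q Z) + NormedSpace.exp (A : 𝔸) * r Z :=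
    ⟨_, h3, fun Z => by simp [add_comm]⟩
  have hF'inj : Function.Injective F' := by
    refine (injective_iff_map_eq_zero F').2 fun Z hZ => ?_
    rw [hF'Z] at hZ
    -- Translated back to the identity, the first term lies in `𝔤` and the second in `ker p`, so
    -- both vanish.
    have h4 : NormedSpace.exp (-(A : 𝔸)) * D (q Z) + r Z = 0 := by
      have := congrArg (NormedSpace.exp (-(A : 𝔸)) * ·) hZ
      simpa only [mul_add, ← mul_assoc, hcancel, one_mul, mul_zero] using this
    have h5 : p (NormedSpace.exp (-(A : 𝔸)) * D (q Z)) = 0 := by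
      have := congrArg p h4
      rwa [map_add, hpr, add_zero, map_zero] at this
    have h6 : NormedSpace.exp (-(A : 𝔸)) * D (q Z) = 0 := by
      have := hp ⟨_, hD𝔤 (q Z) (p Z).2⟩
      rw [h5] at this
      exact (congrArg Subtype.val this).symm
    have h7 : r Z = 0 := by rwa [h6, zero_add] at h4
    rw [h7, mul_zero, add_zero] at hZ
    have h8 : q Z = 0 := hinj (by rw [hZ, map_zero])
    rwa [hr, h8, sub_zero] at h7
  have hF'surj : Function.Surjective F' :=
    LinearMap.injective_iff_surjective (f := F'.toLinearMap).1 hF'inj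
  have hmap := hF'.map_nhds_eq_of_surj (LinearMap.range_eq_top.2 hF'surj)
  rw [hF0] at hmap
  have hW : {Z : 𝔸 | A + p Z ∈ N ∧ ‖r Z‖ < ε} ∈ 𝓝 (0 : 𝔸) := by
    have c1 : Tendsto (fun Z : 𝔸 => A + p Z) (𝓝 0) (𝓝 A) := by
      simpa using (p.continuous.const_add A).tendsto 0
    have c2 : Tendsto (fun Z : 𝔸 => ‖r Z‖) (𝓝 0) (𝓝 0) := by
      simpa using r.continuous.norm.tendsto 0
    exact inter_mem (c1 hN) (c2.eventually (gt_mem_nhds hε))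
  have hW' := image_mem_map (m := F) hW
  rw [hmap] at hW'
  filter_upwards [mem_nhdsWithin_of_mem_nhds hW', self_mem_nhdsWithin] with z hz hzS
  obtain ⟨Z, ⟨hZN, hZε⟩, rfl⟩ := hz
  refine ⟨A + p Z, hZN, ?_⟩
  have h4 : NormedSpace.exp (r Z) ∈ S := by
    have := S.mul_mem (hexp (-((A : 𝔸) + q Z)) (neg_mem (A + p Z).2)) hzS
    rwa [← mul_assoc, hcancel, one_mul] at this
  have h5 : r Z = 0 := hS _ (hpr Z) hZε h4
  simp only [F, h5, NormedSpace.exp_zero, mul_one]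
  rfl

end ClosedSubmonoid

/-! ### Recovering a diagonalizable matrix from its exponential -/

section Diagonalizable

variable {n : ℕ}

open Polynomial in
theorem aeval_units_conj {R 𝔸 : Type*} [CommSemiring R] [Semiring 𝔸] [Algebra R 𝔸] (u : 𝔸ˣ)
    (a : 𝔸) (p : R[X]) : aeval ((u : 𝔸) * a * (↑u⁻¹ : 𝔸)) p = u * aeval a p * (↑u⁻¹ : 𝔸) := by
  induction p using Polynomial.induction_on' with
  | add p q hp hq => simp only [map_add, hp, hq, mul_add, add_mul]
  | monomial k c =>
    rw [aeval_monomial, aeval_monomial, Units.conj_pow, ← mul_assoc (u : 𝔸), ← Algebra.commutes]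
    simp only [mul_assoc]

open Polynomial in
theorem aeval_exp_units_conj_diagonal {P : (Matrix (Fin n) (Fin n) ℂ)ˣ} {d : Fin n → ℂ} {p : ℂ[X]}
    (hp : ∀ i, p.eval (Complex.exp (d i)) = d i) :
    aeval (NormedSpace.exp ((P : Matrix (Fin n) (Fin n) ℂ) * Matrix.diagonal d *
      (↑P⁻¹ : Matrix (Fin n) (Fin n) ℂ))) p =
    (P : Matrix (Fin n) (Fin n) ℂ) * Matrix.diagonal d * (↑P⁻¹ : Matrix (Fin n) (Fin n) ℂ) := by
  rw [Matrix.exp_units_conj, Matrix.exp_diagonal, aeval_units_conj]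
  have h1 : aeval (Matrix.diagonal (NormedSpace.exp d)) p = Matrix.diagonal d := by
    have h2 := aeval_algHom_apply (Matrix.diagonalAlgHom ℂ (n := Fin n) (α := ℂ))
      (NormedSpace.exp d) p
    refine h2.trans ?_
    rw [Polynomial.aeval_pi_apply]
    change Matrix.diagonal _ = _
    congr 1
    funext i
    rw [Pi.coe_exp, ← Complex.exp_eq_exp_ℂ, Polynomial.coe_aeval_eq_eval]
    exact hp i
  rw [h1]

theorem mem_spectrum_units_conj_diagonal (P : (Matrix (Fin n) (Fin n) ℂ)ˣ) (d : Fin n → ℂ)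
    (i : Fin n) : d i ∈ spectrum ℂ ((P : Matrix (Fin n) (Fin n) ℂ) * Matrix.diagonal d *
      (↑P⁻¹ : Matrix (Fin n) (Fin n) ℂ)) := by
  rw [spectrum.units_conjugate, spectrum_diagonal]
  exact ⟨i, rfl⟩

end Diagonalizable

/-! ### The exponential on the strip `U` -/

section MatrixGroup

variable {n : ℕ} {G : Subgroup (GL (Fin n) ℂ)}

/-- The elements of a matrix group, as a submonoid of the algebra of all matrices. -/
def matrixSubmonoid (G : Subgroup (GL (Fin n) ℂ)) : Submonoid (Matrix (Fin n) (Fin n) ℂ) :=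
  G.toSubmonoid.map (Units.coeHom _)

theorem isClosed_matrixSet (hG : IsCompact (G : Set (GL (Fin n) ℂ))) : IsClosed (matrixSet G) :=
  (hG.image Units.continuous_val).isClosed

theorem exp_mul_exp_neg (Y : Matrix (Fin n) (Fin n) ℂ) :
    NormedSpace.exp Y * NormedSpace.exp (-Y) = 1 := by
  rw [← Matrix.exp_add_of_commute _ _ (Commute.refl Y).neg_right, add_neg_cancel,
    NormedSpace.exp_zero]

theorem exp_neg_mem_matrixSet {Y : Matrix (Fin n) (Fin n) ℂ}
    (hY : NormedSpace.exp Y ∈ matrixSet G) : NormedSpace.exp (-Y) ∈ matrixSet G := by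
  obtain ⟨g, hg, h⟩ := hY
  have h : (g : Matrix (Fin n) (Fin n) ℂ) = NormedSpace.exp Y := h
  refine ⟨g⁻¹, G.inv_mem hg, ?_⟩
  refine Units.inv_eq_of_mul_eq_one_right ?_
  rw [h, exp_mul_exp_neg]

theorem exp_mem_matrixSet (hG : IsCompact (G : Set (GL (Fin n) ℂ)))
    {X : Matrix (Fin n) (Fin n) ℂ} (hX : X ∈ lieAlgebraOf G) :
    NormedSpace.exp X ∈ matrixSet G := by
  obtain ⟨γ, -, hγ, h0, hd⟩ := hX
  exact exp_mem_of_hasDerivAt (S := matrixSubmonoid G) (isClosed_matrixSet hG) hγ h0 hd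

theorem contDiff_matrix_exp :
    ContDiff ℝ ∞ (NormedSpace.exp : Matrix (Fin n) (Fin n) ℂ → Matrix (Fin n) (Fin n) ℂ) :=
  contDiff_iff_contDiffAt.2 fun A => (NormedSpace.exp_analytic (𝕂 := ℝ) A).contDiffAt

theorem mem_lieAlgebraOf_of_forall_exp_smul_mem {X : Matrix (Fin n) (Fin n) ℂ}
    (h : ∀ t : ℝ, NormedSpace.exp (t • X) ∈ matrixSet G) : X ∈ lieAlgebraOf G := by
  refine ⟨fun t => NormedSpace.exp (t • X),
    contDiff_matrix_exp.comp (contDiff_id.smul contDiff_const), h, by simp, ?_⟩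
  have h1 := hasDerivAt_exp_smul_const (𝕂 := ℝ) X (0 : ℝ)
  rw [zero_smul, NormedSpace.exp_zero, one_mul] at h1
  exact h1

/-- It is the velocity at `0` of the curve `exp(-A) exp(A + t X)`, which stays in `G` and starts at
the identity. -/
theorem exp_neg_mul_fderiv_mem_lieAlgebraOf (hG : IsCompact (G : Set (GL (Fin n) ℂ)))
    {A X : Matrix (Fin n) (Fin n) ℂ} (hA : A ∈ lieAlgebraOf G) (hX : X ∈ lieAlgebraOf G)
    {D : Matrix (Fin n) (Fin n) ℂ →L[ℝ] Matrix (Fin n) (Fin n) ℂ}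
    (hD : HasFDerivAt (𝕜 := ℝ) NormedSpace.exp D A) :
    NormedSpace.exp (-A) * D X ∈ lieAlgebraOf G := by
  refine ⟨fun t => NormedSpace.exp (-A) * NormedSpace.exp (A + t • X), ?_, fun t => ?_, ?_, ?_⟩
  · exact contDiff_const.mul (contDiff_matrix_exp.comp
      (contDiff_const.add (contDiff_id.smul contDiff_const)))
  · exact (matrixSubmonoid G).mul_mem (exp_mem_matrixSet hG (neg_mem hA))
      (exp_mem_matrixSet hG (add_mem hA (Submodule.smul_mem _ t hX)))
  · have := exp_mul_exp_neg (-A)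
    simpa using this
  · exact (hasDerivAt_exp_line hD X).const_mul _

theorem exists_hasFDerivAt_exp_bijective {A : lieAlgebraOf G} (hA : A ∈ eigenvalueStrip G) :
    ∃ D : Matrix (Fin n) (Fin n) ℂ →L[ℝ] Matrix (Fin n) (Fin n) ℂ,
      HasFDerivAt (𝕜 := ℝ) NormedSpace.exp D (A : Matrix (Fin n) (Fin n) ℂ) ∧
      Function.Bijective D := by
  have h1 : HasFDerivAt (𝕜 := ℂ) NormedSpace.exp _ (A : Matrix (Fin n) (Fin n) ℂ) :=
    (NormedSpace.exp_analytic (𝕂 := ℂ) (A : Matrix (Fin n) (Fin n) ℂ)).differentiableAt.hasFDerivAt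
  refine ⟨_, h1.restrictScalars ℝ, ?_⟩
  by_contra hcon
  obtain ⟨z, hz, w, hw, k, hk, hzw⟩ := (not_bijective_fderiv_exp_iff h1).1 hcon
  have hz' := abs_lt.1 (hA z hz)
  have hw' := abs_lt.1 (hA w hw)
  have him : z.im - w.im = 2 * Real.pi * k := by
    have := congrArg Complex.im hzw
    simpa using this
  have hpi := Real.pi_pos
  have h2 : |(k : ℝ)| < 1 := by
    rw [abs_lt]
    constructor <;> nlinarith
  have h3 : |k| < 1 := by exact_mod_cast h2
  exact hk (Int.abs_lt_one_iff.1 h3)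

theorem exists_continuousLinearMap_projection (G : Subgroup (GL (Fin n) ℂ)) :
    ∃ p : Matrix (Fin n) (Fin n) ℂ →L[ℝ] lieAlgebraOf G, ∀ X : lieAlgebraOf G, p X = X := by
  obtain ⟨p, hp⟩ := LinearMap.exists_extend (LinearMap.id : lieAlgebraOf G →ₗ[ℝ] lieAlgebraOf G)
  exact ⟨LinearMap.toContinuousLinearMap p, fun X => LinearMap.congr_fun hp X⟩

open Filter Topology in
/-- Near the exponential of a point `A` of `U`, the elements of `G` are the exponentials of the
points of `U` near `A`. -/
theorem eventually_exists_lieExp_eq (hG : IsCompact (G : Set (GL (Fin n) ℂ)))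
    {A : lieAlgebraOf G} (hA : A ∈ eigenvalueStrip G) {N : Set (lieAlgebraOf G)} (hN : N ∈ 𝓝 A) :
    ∀ᶠ z in 𝓝[matrixSet G] (lieExp G A), ∃ B ∈ N, lieExp G B = z := by
  obtain ⟨D, hD, hinj, -⟩ := exists_hasFDerivAt_exp_bijective hA
  obtain ⟨p, hp⟩ := exists_continuousLinearMap_projection G
  have hcl : IsClosed (matrixSubmonoid G : Set (Matrix (Fin n) (Fin n) ℂ)) := isClosed_matrixSet hG
  obtain ⟨ε, hε, hS⟩ := exists_forall_exp_mem_eq_zero (S := matrixSubmonoid G) hcl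
    -- A direction whose one-parameter group lies in `G` belongs to the Lie algebra, where `p` is
    -- the identity.
    (fun Y hY => exp_neg_mem_matrixSet hY) p fun X hX hpX => by
      have h1 : (⟨X, mem_lieAlgebraOf_of_forall_exp_smul_mem hX⟩ : lieAlgebraOf G) = 0 :=
        (hp _).symm.trans hpX
      exact congrArg Subtype.val h1
  exact eventually_exists_exp_eq (S := matrixSubmonoid G) hp
    (fun X hX => exp_mem_matrixSet hG hX) hε hS hD hinj
    (fun X hX => exp_neg_mul_fderiv_mem_lieAlgebraOf hG A.2 hX hD) hN

/-- The spectrum is upper hemicontinuous, so it stays inside the open strip under small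
perturbations. -/
theorem isOpen_eigenvalueStrip : IsOpen (eigenvalueStrip G) := by
  have hU : IsOpen {z : ℂ | |z.im| < Real.pi} :=
    isOpen_lt Complex.continuous_im.abs continuous_const
  have h1 : UpperHemicontinuous (spectrum ℂ : Matrix (Fin n) (Fin n) ℂ → Set ℂ) :=
    upperHemicontinuous_spectrum ℂ _
  rw [isOpen_iff_mem_nhds]
  intro A hA
  exact (continuous_subtype_val.tendsto A).eventually (h1.forall_isOpen A _ hU hA)

theorem isBounded_eigenvalueStrip (hG : IsCompact (G : Set (GL (Fin n) ℂ))) :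
    Bornology.IsBounded (eigenvalueStrip G) := by
  obtain ⟨C, hC⟩ := exists_diagonalization hG
  refine isBounded_iff_forall_norm_le.2 ⟨C * Real.pi * C, fun A hA => ?_⟩
  obtain ⟨P, d, hAd, hP, hP', hd⟩ := hC A A.2
  change ‖(A : Matrix (Fin n) (Fin n) ℂ)‖ ≤ _
  have hdn : ‖Matrix.diagonal d‖ ≤ Real.pi := by
    rw [Matrix.linfty_opNorm_diagonal]
    refine (pi_norm_le_iff_of_nonneg Real.pi_pos.le).2 fun i => ?_
    have h1 := hA (d i) (hAd ▸ mem_spectrum_units_conj_diagonal P d i)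
    refine (Complex.norm_le_abs_re_add_abs_im _).trans ?_
    rw [hd, abs_zero, zero_add]
    exact h1.le
  have hC0 : 0 ≤ C := (norm_nonneg _).trans hP
  rw [hAd]
  refine (norm_mul_le _ _).trans (mul_le_mul ((norm_mul_le _ _).trans ?_) hP' (norm_nonneg _)
    (by positivity))
  exact mul_le_mul hP hdn (norm_nonneg _) hC0

theorem injOn_lieExp (hG : IsCompact (G : Set (GL (Fin n) ℂ))) :
    Set.InjOn (lieExp G) (eigenvalueStrip G) := by
  obtain ⟨C, hC⟩ := exists_diagonalization hG
  intro A hA B hB hAB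
  obtain ⟨P, d, hAd, -, -, -⟩ := hC A A.2
  obtain ⟨Q, e, hBe, -, -, -⟩ := hC B B.2
  have hstrip {z : ℂ} (hz : z ∈ Finset.univ.image d ∪ Finset.univ.image e) :
      |z.im| < Real.pi := by
    simp only [Finset.mem_union, Finset.mem_image, Finset.mem_univ, true_and] at hz
    rcases hz with ⟨i, rfl⟩ | ⟨i, rfl⟩
    · exact hA _ (hAd ▸ mem_spectrum_units_conj_diagonal P d i)
    · exact hB _ (hBe ▸ mem_spectrum_units_conj_diagonal Q e i)
  have hinj : Set.InjOn Complex.exp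
      (Finset.univ.image d ∪ Finset.univ.image e : Finset ℂ) := by
    intro z hz w hw hzw
    have h1 := abs_lt.1 (hstrip hz)
    have h2 := abs_lt.1 (hstrip hw)
    exact Complex.exp_inj_of_neg_pi_lt_of_le_pi h1.1 h1.2.le h2.1 h2.2.le hzw
  -- The nodes are the exponentials of the eigenvalues of both matrices, so that `p(exp A) = A` and
  -- `p(exp B) = B` hold for the same `p`.
  let p := Lagrange.interpolate (Finset.univ.image d ∪ Finset.univ.image e) Complex.exp id
  have hp {z : ℂ} (hz : z ∈ Finset.univ.image d ∪ Finset.univ.image e) :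
      p.eval (Complex.exp z) = z := Lagrange.eval_interpolate_at_node id hinj hz
  have h1 := aeval_exp_units_conj_diagonal (P := P) (d := d) (p := p) fun i =>
    hp (Finset.mem_union_left _ (Finset.mem_image_of_mem _ (Finset.mem_univ i)))
  have h2 := aeval_exp_units_conj_diagonal (P := Q) (d := e) (p := p) fun i =>
    hp (Finset.mem_union_right _ (Finset.mem_image_of_mem _ (Finset.mem_univ i)))
  rw [← hAd] at h1
  rw [← hBe] at h2
  have hAB : NormedSpace.exp (A : Matrix (Fin n) (Fin n) ℂ) =
    NormedSpace.exp (B : Matrix (Fin n) (Fin n) ℂ) := hAB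
  exact Subtype.ext (by rw [← h1, hAB, h2])

open Filter Topology in
theorem exists_analyticOn_log (hG : IsCompact (G : Set (GL (Fin n) ℂ))) :
    ∃ L : Matrix (Fin n) (Fin n) ℂ → lieAlgebraOf G,
      (∀ A ∈ eigenvalueStrip G, L (lieExp G A) = A) ∧
      AnalyticOn ℝ L (lieExp G '' eigenvalueStrip G) := by
  have hL := (injOn_lieExp hG).leftInvOn_invFunOn
  refine ⟨_, hL, ?_⟩
  rintro _ ⟨A, hA, rfl⟩
  obtain ⟨D, hD, hbij⟩ := exists_hasFDerivAt_exp_bijective hA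
  obtain ⟨p, hp⟩ := exists_continuousLinearMap_projection G
  obtain ⟨ψ, hψ, hl, -⟩ := exists_analyticAt_leftInverse_exp hD hbij
  refine analyticWithinAt_iff_exists_analyticAt.2
    ⟨fun z => p (ψ z), ?_, (p.analyticAt _).comp hψ⟩
  rw [Set.insert_eq_of_mem (Set.mem_image_of_mem _ hA)]
  have hN : {B : lieAlgebraOf G | ψ (lieExp G B) = B} ∩ eigenvalueStrip G ∈ 𝓝 A :=
    inter_mem ((continuous_subtype_val.tendsto A).eventually hl)
      (isOpen_eigenvalueStrip.mem_nhds hA)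
  have hsub : lieExp G '' eigenvalueStrip G ⊆ matrixSet G := by
    rintro _ ⟨B, -, rfl⟩
    exact exp_mem_matrixSet hG B.2
  -- Points of `exp(U)` near `exp(A)` have a preimage in `U` near `A`. By injectivity it is the
  -- value of the global inverse, and `ψ` also returns it.
  filter_upwards [nhdsWithin_mono _ hsub (eventually_exists_lieExp_eq hG hA hN)] with z hz
  obtain ⟨B, ⟨hB, hBU⟩, rfl⟩ := hz
  rw [hL hBU]
  have hB : ψ (lieExp G B) = B := hB
  rw [hB, hp]

open Filter Topology in
theorem isOpen_preimage_lieExp_image (hG : IsCompact (G : Set (GL (Fin n) ℂ))) :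
    IsOpen {g : G | ((g : GL (Fin n) ℂ) : Matrix (Fin n) (Fin n) ℂ) ∈
      lieExp G '' eigenvalueStrip G} := by
  rw [isOpen_iff_mem_nhds]
  rintro g ⟨A, hA, hg⟩
  have h1 : Tendsto (fun g : G => ((g : GL (Fin n) ℂ) : Matrix (Fin n) (Fin n) ℂ)) (𝓝 g)
      (𝓝[matrixSet G] (lieExp G A)) := by
    rw [hg]
    exact tendsto_nhdsWithin_iff.2
      ⟨(Units.continuous_val.comp continuous_subtype_val).tendsto g,
        Eventually.of_forall fun k => ⟨k, k.2, rfl⟩⟩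
  exact h1.eventually
    (eventually_exists_lieExp_eq hG hA (isOpen_eigenvalueStrip.mem_nhds hA))

end MatrixGroup

/-- A compact connected matrix Lie group is a compact (hence closed) connected subgroup of
`GL(n, ℂ)`. A map defined on a subset of the space of matrices, such as the inverse of `exp` on
`exp(U) ⊆ G`, is real analytic when near each point of the subset it is the sum of a power series
in the ambient coordinates; this is `AnalyticOn`. -/
theorem mainTheorem4 (n : ℕ) (G : Subgroup (GL (Fin n) ℂ))
    (hcompact : IsCompact (G : Set (GL (Fin n) ℂ)))
    (hconnected : IsConnected (G : Set (GL (Fin n) ℂ))) :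
    -- `exp` maps the Lie algebra into `G`
    (∀ A : lieAlgebraOf G, lieExp G A ∈ matrixSet G) ∧
    -- `U` is a bounded open neighbourhood of the origin of the Lie algebra
    (0 : lieAlgebraOf G) ∈ eigenvalueStrip G ∧
    IsOpen (eigenvalueStrip G) ∧
    Bornology.IsBounded (eigenvalueStrip G) ∧
    -- `exp` is analytic and injective on `U`
    AnalyticOnNhd ℝ (lieExp G) (eigenvalueStrip G) ∧
    Set.InjOn (lieExp G) (eigenvalueStrip G) ∧
    -- `exp(U)` is open in `G`, and the inverse of `exp` is analytic on it
    IsOpen {g : G | ((g : GL (Fin n) ℂ) : Matrix (Fin n) (Fin n) ℂ) ∈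
      lieExp G '' eigenvalueStrip G} ∧
    (∃ L : Matrix (Fin n) (Fin n) ℂ → lieAlgebraOf G,
      (∀ A ∈ eigenvalueStrip G, L (lieExp G A) = A) ∧
      AnalyticOn ℝ L (lieExp G '' eigenvalueStrip G)) ∧
    -- on all of `M_n(ℂ)`, the differential of `exp` at `A` is singular exactly when two
    -- eigenvalues of `A` differ by a nonzero integer multiple of `2πi`
    (∀ A : Matrix (Fin n) (Fin n) ℂ,
      ∃ D : Matrix (Fin n) (Fin n) ℂ →L[ℂ] Matrix (Fin n) (Fin n) ℂ,
        HasFDerivAt (𝕜 := ℂ) NormedSpace.exp D A ∧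
        (¬ Function.Bijective D ↔
          ∃ z ∈ spectrum ℂ A, ∃ w ∈ spectrum ℂ A, ∃ k : ℤ, k ≠ 0 ∧
            z - w = 2 * (Real.pi : ℂ) * Complex.I * (k : ℂ))) := by
  refine ⟨fun A => exp_mem_matrixSet hcompact A.2, ?_, isOpen_eigenvalueStrip,
    isBounded_eigenvalueStrip hcompact, fun A _ => ?_, injOn_lieExp hcompact,
    isOpen_preimage_lieExp_image hcompact, exists_analyticOn_log hcompact, fun A => ?_⟩
  · intro z hz
    -- For `n = 0` the spectrum is empty, so the given `z` excludes this case.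
    have hn : Nontrivial (Matrix (Fin n) (Fin n) ℂ) := by
      by_contra hn
      rw [not_nontrivial_iff_subsingleton] at hn
      rw [spectrum.of_subsingleton] at hz
      exact hz
    rw [ZeroMemClass.coe_zero, spectrum.zero_eq, Set.mem_singleton_iff] at hz
    rw [hz, Complex.zero_im, abs_zero]
    exact Real.pi_pos
  · have h1 : AnalyticAt ℝ (NormedSpace.exp : Matrix (Fin n) (Fin n) ℂ → _)
      ((lieAlgebraOf G).subtypeL A) := NormedSpace.exp_analytic _
    exact h1.comp ((lieAlgebraOf G).subtypeL.analyticAt A)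
  · have h1 := (NormedSpace.exp_analytic (𝕂 := ℂ) A).differentiableAt.hasFDerivAt
    exact ⟨_, h1, not_bijective_fderiv_exp_iff h1⟩
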